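/- Let $F$ be a field, let $a_1,\dots,a_n\in F$ be distinct, and let $l\ge 1$ be an integer. The Shpilka–Volkovich generator $\mathrm{SV}_l$ with abscissas $a_1,\dots,a_n$ is the substitution $$x_i \;\gets\; \sum_{j=1}^{l} z_j\,L_i(y_j),\qquad L_i(y)=\prod_{k\in[n]\setminus\{i\}}\frac{y-a_k}{a_i-a_k}\qquad (i\in[n]),$$ in the $2l$ fresh variables $y_1,\dots,y_l,z_1,\dots,z_l$. Its vanishing ideal consists of all $p\in F[x_1,\dots,x_n]$ for which $p(\mathrm{SV}_l)$ is the zero polynomial in $F[y_1,\dots,y_l,z_1,\dots,z_l]$. A read-once oblivious algebraic branching program (ROABP) over $F$ in $x_1,\dots,x_n$ consists of a permutation $\pi$ of $[n]$ and a layered directed graph with layers $0,1,\dots,n$, where layer $0$ consists of a single source and layer $n$ of a single sink, and each edge goes from some layer $i-1$ to layer $i$ and is labeled by a univariate polynomial over $F$ in the variable $x_{\pi(i)}$. It computes the sum, over all paths from the source to the sink, of the product of the edge labels along the path. Its width is the maximum number of nodes in a layer. Theorem. (1) $\mathrm{SV}_l$ hits the class of polynomials that are computed by an ROABP of width less than $\frac{l}{3}+1$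 and contain a monomial of degree at most $l+1$: for every nonzero $p$ in this class, $p(\mathrm{SV}_l)\neq 0$. (2) Equivalently, every ROABP that computes a nonzero polynomial of degree $l+1$ in the vanishing ideal of $\mathrm{SV}_l$ has width at least $\frac{l}{3}+1$. -/

import Mathlib

open MvPolynomial

noncomputable section

/-- A read-once oblivious algebraic branching program in the variables `x_0, …, x_{n-1}` over `F`:
a layered directed graph with layers `0, …, n`, the first consisting of the source only and the last
of the sink only. Each edge from layer `i` to layer `i + 1` is labeled by a univariate polynomial,
of arbitrary degree, in the single variable `x_{order i}`. A pair of nodes that is not joined by an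
edge has the label `0`. -/
structure ROABP (F : Type*) [Field F] (n : ℕ) where
  /-- the order in which the variables are read -/
  order : Equiv.Perm (Fin n)
  /-- the number of nodes of each layer -/
  size : Fin (n + 1) → ℕ
  size_zero : size 0 = 1
  size_last : size (Fin.last n) = 1
  /-- the labels of the edges from layer `i` to layer `i + 1` -/
  label : (i : Fin n) → Fin (size i.castSucc) → Fin (size i.succ) → Polynomial F

namespace ROABP

variable {F : Type*} [Field F] {n : ℕ}

/-- The maximum number of nodes in a layer. -/
def width (P : ROABP F n) : ℕ := Finset.univ.sup P.size

/-- A path from the source to the sink: one node in every layer. -/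
abbrev Path (P : ROABP F n) : Type := (i : Fin (n + 1)) → Fin (P.size i)

/-- The polynomial computed by the program: the sum, over all paths from the source to the sink, of
the product of the labels on the edges of the path. -/
def poly (P : ROABP F n) : MvPolynomial (Fin n) F :=
  ∑ q : P.Path, ∏ i : Fin n,
    Polynomial.aeval (X (P.order i) : MvPolynomial (Fin n) F)
      (P.label i (q i.castSucc) (q i.succ))

end ROABP

/-- The Shpilka–Volkovich generator with parameter `l` for the abscissas `a`. The seed variables are
`y_j = X (Sum.inl j)` and `z_j = X (Sum.inr j)` for `j < l`, and `x_i` is replaced by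
`∑ j, z_j * L_i(y_j)`, where `L_i` is the Lagrange interpolant with `L_i(a_i) = 1` and
`L_i(a_j) = 0` for `j ≠ i`. -/
def svGenerator {F : Type*} [Field F] {n : ℕ} (a : Fin n → F) (l : ℕ) :
    Fin n → MvPolynomial (Fin l ⊕ Fin l) F :=
  fun i => ∑ j : Fin l,
    X (Sum.inr j) *
      Polynomial.aeval (X (Sum.inl j) : MvPolynomial (Fin l ⊕ Fin l) F)
        (Lagrange.basis Finset.univ a i)

/-- The vanishing ideal of a polynomial substitution `G`: all `p` such that `p(G)` is the zero
polynomial in the seed variables. -/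
def vanishingIdealOf {F : Type*} [Field F] {n : ℕ} {τ : Type*} (G : Fin n → MvPolynomial τ F) :
    Ideal (MvPolynomial (Fin n) F) :=
  RingHom.ker (aeval G : MvPolynomial (Fin n) F →ₐ[F] MvPolynomial τ F)

/-- The substitution `G` hits the class `C`: `p(G)` is nonzero for every nonzero `p` in `C`. -/
def Hits {F : Type*} [Field F] {n : ℕ} {τ : Type*} (G : Fin n → MvPolynomial τ F)
    (C : Set (MvPolynomial (Fin n) F)) : Prop :=
  ∀ p ∈ C, p ≠ 0 → aeval G p ≠ 0

end

/-!
Let `p` lie in the vanishing ideal of `SV_l`. Specializing the seed to nodes `y_j = a_i` frees any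
`l` variables and sets the others to zero, so every monomial of `p` involves more than `l`
variables. Hence the monomials of degree at most `l + 1` are squarefree of degree exactly `l + 1`.
Differentiating `p(SV_l) = 0` in one `y_j` before this specialization gives linear relations
between their coefficients: after the variables are rescaled by the nodal weights, for every set `L`
of `l` variables and every `i ∈ L`,
`∑ s ∉ L, c (L ∪ {s}) / (a_s - a_i) = 0` (`sum_inv_sub_mul_scaledCoeff_eq_zero`).

Cut the variables into `U` and `V`. The matrix of coefficients `c (S ∪ T)`, `S ⊆ U`, `T ⊆ V`, of the
part of degree `l + 1` has rank at most the size of the layer of the program at the cut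
(`ROABP.rank_coeff_le_size`, `Matrix.rank_le_rank_of_initial`). The rank is bounded from below by
means of the derivatives `∑ u ∈ U, (a_u - x)⁻¹ ∂/∂x_u` and their counterparts on `V`. The relations
say that, for `x` a node of `S ∪ T`, the sum of the two derivatives vanishes at `(S, T)`.
Whenever such a derivative kills a nonzero row or column without killing the whole matrix, it lowers
the rank, at the price of at most one degree on either side. One can continue in this manner until the degree
on one side is exhausted; what prevents the derivatives from all vanishing earlier is that Cauchy
matrices have linearly independent columns (`lt_rank_of_poleDeriv_eq_zero`,
`lt_rank_of_poleDeriv_add_eq_zero`). If the least degree in `U` is `m`, the rank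
therefore exceeds `min m (l + 1 - m)`. Along the order of the program the least degree
grows in steps of at most one from `0` to `l + 1`, so some cut has `m = (l + 1) / 2`
(`exists_cut`). The width is thus more than `(l + 1) / 2`, rounded down, hence at least
`l / 3 + 1` (`ROABP.half_lt_width`).
-/

/-! ### Cauchy matrices -/

section Cauchy

variable {F : Type*} [Field F] {U V : Type*} [DecidableEq U]

/-- A nonzero combination of the functions `v ↦ 1 / (a u - b v)`, `u ∈ A`, has fewer than `#A` zeros
among the points of `b`: its numerator is a nonzero polynomial of degree less than `#A`. -/
lemma card_lt_card_of_sum_inv_sub_mul_eq_zero {a : U → F} {b : V → F}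
    (ha : Function.Injective a) (hb : Function.Injective b) (hab : ∀ u v, a u ≠ b v)
    (A : Finset U) (B : Finset V) (f : U → F) {u₀ : U} (hu₀ : u₀ ∈ A) (hf : f u₀ ≠ 0)
    (h : ∀ v ∈ B, ∑ u ∈ A, (a u - b v)⁻¹ * f u = 0) : B.card < A.card := by
  by_contra! hle
  -- The numerator is, up to sign, the polynomial that interpolates `r`.
  set r : U → F := fun u => f u / Lagrange.nodalWeight A a u with hr
  have hw : ∀ u ∈ A, Lagrange.nodalWeight A a u ≠ 0 := fun u hu =>
    Lagrange.nodalWeight_ne_zero ha.injOn hu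
  have hzero : Lagrange.interpolate A a r = 0 := by
    refine Polynomial.eq_zero_of_degree_lt_of_eval_index_eq_zero (s := B) (v := b) hb.injOn
      ((Lagrange.degree_interpolate_lt r ha.injOn).trans_le (by exact_mod_cast hle)) fun v hv => ?_
    rw [Lagrange.eval_interpolate_not_at_node _ fun u _ => (hab u v).symm]
    have : ∑ u ∈ A, Lagrange.nodalWeight A a u * (b v - a u)⁻¹ * r u
        = -∑ u ∈ A, (a u - b v)⁻¹ * f u := by
      rw [← Finset.sum_neg_distrib]
      refine Finset.sum_congr rfl fun u hu => ?_
      rw [← neg_sub (a u), inv_neg, hr]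
      field_simp [hw u hu]
    rw [this, h v hv, neg_zero, mul_zero]
  have := Lagrange.eval_interpolate_at_node r ha.injOn hu₀
  rw [hzero, Polynomial.eval_zero, hr] at this
  exact div_ne_zero hf (hw _ hu₀) this.symm

end Cauchy

/-! ### Rank -/

namespace Matrix

lemma rank_pos_of_ne_zero {F m n : Type*} [Field F] [Fintype n] {M : Matrix m n F}
    (hM : M ≠ 0) [Fintype m] : 0 < M.rank := by
  rw [Nat.pos_iff_ne_zero]
  intro h
  apply hM
  rw [rank, Submodule.finrank_eq_zero, LinearMap.range_eq_bot] at h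
  classical
  ext i j
  have := congrFun (LinearMap.congr_fun h (Pi.single j 1)) i
  simpa using this

/-- A linear map that kills a nonzero vector of the column space lowers the rank. -/
lemma rank_mul_lt {F l m n : Type*} [Field F] [Fintype l] [Fintype m] [Fintype n]
    (A : Matrix l m F) (M : Matrix m n F) (j : n) {i : m} (hij : M i j ≠ 0)
    (hA : ∀ k, (A * M) k j = 0) : (A * M).rank < M.rank := by
  classical
  have hrank : (A * M).rank = Module.finrank F (M.mulVecLin.range.map A.mulVecLin) := by
    rw [rank, mulVecLin_mul, LinearMap.range_comp]
  have hker := LinearMap.finrank_range_add_finrank_ker (A.mulVecLin.domRestrict M.mulVecLin.range)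
  rw [LinearMap.range_domRestrict, ← hrank] at hker
  have hpos : 0 < Module.finrank F (A.mulVecLin.domRestrict M.mulVecLin.range).ker := by
    rw [Nat.pos_iff_ne_zero]
    intro h
    have hmem : (⟨M.mulVecLin (Pi.single j 1), LinearMap.mem_range_self _ _⟩ : M.mulVecLin.range) ∈
        (A.mulVecLin.domRestrict M.mulVecLin.range).ker := by
      change A *ᵥ (M *ᵥ Pi.single j 1) = 0
      rw [mulVec_mulVec]
      ext k
      simpa using hA k
    rw [Submodule.finrank_eq_zero.mp h, Submodule.mem_bot] at hmem
    have := congrFun (congrArg Subtype.val hmem) i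
    simp [hij] at this
  change _ < Module.finrank F M.mulVecLin.range
  omega

end Matrix

/-! ### Directional derivatives of multilinear polynomials -/

section Derivation

variable {F : Type*} [Field F] {U : Type*} [Fintype U] [DecidableEq U]

/-- The directional derivative `∑ u, w u * ∂/∂x_u` on multilinear polynomials, as a matrix in the
basis of squarefree monomials; a monomial is represented by its set of variables. -/
def dirDeriv (w : U → F) : Matrix (Finset U) (Finset U) F :=
  fun S R => ∑ u ∈ Sᶜ, if R = insert u S then w u else 0

lemma dirDeriv_mul_apply {β : Type*} (w : U → F) (c : Matrix (Finset U) β F) (S : Finset U)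
    (T : β) : (dirDeriv w * c) S T = ∑ u ∈ Sᶜ, w u * c (insert u S) T := by
  simp only [Matrix.mul_apply, dirDeriv, Finset.sum_mul]
  rw [Finset.sum_comm]
  simp [ite_mul]

lemma mul_dirDeriv_transpose_apply {α : Type*} (w : U → F) (c : Matrix α (Finset U) F) (S : α)
    (T : Finset U) :
    (c * (dirDeriv w).transpose) S T = ∑ u ∈ Tᶜ, w u * c S (insert u T) := by
  rw [← Matrix.transpose_apply (c * _), Matrix.transpose_mul, Matrix.transpose_transpose,
    dirDeriv_mul_apply]
  rfl

lemma dirDeriv_mul_comm (w w' : U → F) : dirDeriv w * dirDeriv w' = dirDeriv w' * dirDeriv w := by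
  ext S R
  simp only [dirDeriv_mul_apply]
  simp only [dirDeriv, Finset.mul_sum]
  rw [Finset.sum_comm' (t' := Sᶜ) (s' := fun y => (insert y S)ᶜ) (fun x y => ?_)]
  rotate_left
  · simp only [Finset.mem_compl, Finset.mem_insert]; tauto
  · refine Finset.sum_congr rfl fun y _ => Finset.sum_congr rfl fun x _ => ?_
    rw [Finset.insert_comm]
    split_ifs <;> ring

end Derivation

/-! ### Rank bounds for coefficient matrices -/

section Rank

variable {F : Type*} [Field F] {U V : Type*} [Fintype U] [DecidableEq U] [Fintype V]
  [DecidableEq V]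

/-- The derivative in the direction `(1 / (a u - x))_u`, called the derivative with pole at `x`. The
coordinate of a variable whose node is `x` itself is the junk value `0⁻¹ = 0`. -/
abbrev poleDeriv (a : U → F) (x : F) : Matrix (Finset U) (Finset U) F :=
  dirDeriv fun u => (a u - x)⁻¹

omit [Fintype V] [DecidableEq V] in
/-- If the derivatives with poles at the points of `B` all vanish on `c`, then `c` involves more
variables than `B` has points. -/
lemma card_lt_card_of_poleDeriv_mul_eq_zero {β : Type*} {a : U → F} {b : V → F}
    (ha : Function.Injective a) (hb : Function.Injective b) (hab : ∀ u v, a u ≠ b v)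
    (c : Matrix (Finset U) β F) (A : Finset U) (B : Finset V)
    (hA : ∀ S T, c S T ≠ 0 → S ⊆ A) {S : Finset U} {T : β} (hc : c S T ≠ 0) (hS : S.Nonempty)
    (h : ∀ v ∈ B, poleDeriv a (b v) * c = 0) : B.card < A.card := by
  obtain ⟨u₀, hu₀⟩ := hS
  -- The coefficients along the variables that complete `S \ {u₀}` to a monomial.
  set f : U → F := fun u => if u ∈ S.erase u₀ then 0 else c (insert u (S.erase u₀)) T with hf
  refine card_lt_card_of_sum_inv_sub_mul_eq_zero ha hb hab A B f (hA _ _ hc hu₀)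
    (by simpa [hf, Finset.insert_erase hu₀] using hc) fun v hv => ?_
  have h0 : (poleDeriv a (b v) * c) (S.erase u₀) T = 0 := by rw [h v hv]; rfl
  rw [dirDeriv_mul_apply] at h0
  calc ∑ u ∈ A, (a u - b v)⁻¹ * f u = ∑ u, (a u - b v)⁻¹ * f u := by
        refine Finset.sum_subset (Finset.subset_univ A) fun u _ hu => ?_
        rw [mul_eq_zero, or_iff_not_imp_right]
        intro hfu
        by_cases hu' : u ∈ S.erase u₀
        · exact absurd (if_pos hu') hfu
        · rw [hf] at hfu
          simp only [hu', if_false] at hfu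
          exact absurd (hA _ _ hfu (Finset.mem_insert_self _ _)) hu
    _ = ∑ u ∈ (S.erase u₀)ᶜ, (a u - b v)⁻¹ * f u := by
        refine (Finset.sum_subset (Finset.subset_univ _) fun u _ hu => ?_).symm
        rw [Finset.mem_compl, not_not] at hu
        rw [show f u = 0 from if_pos hu, mul_zero]
    _ = ∑ u ∈ (S.erase u₀)ᶜ, (a u - b v)⁻¹ * c (insert u (S.erase u₀)) T := by
        refine Finset.sum_congr rfl fun u hu => ?_
        rw [Finset.mem_compl] at hu
        simp only [hf, hu, if_false]
    _ = 0 := h0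

/-- A nonzero matrix of multilinear coefficients whose columns `T` are killed by the derivatives
with poles at the points of `T`, and whose rows `S` by those with poles at the points of `S`, has
rank more than `k` if all its monomials have degree at least `k` on either side. A derivative with
pole at a point that occurs in some monomial lowers the rank, and the degree on one side by one.
As long as both degrees are positive, one of these derivatives is nonzero: otherwise Cauchy
matrices would force more variables to occur on the left than on the right, and vice versa. -/
theorem lt_rank_of_poleDeriv_eq_zero {a : U → F} {b : V → F}
    (ha : Function.Injective a) (hb : Function.Injective b) (hab : ∀ u v, a u ≠ b v) (k : ℕ)
    (c : Matrix (Finset U) (Finset V) F) (hc : c ≠ 0)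
    (hdeg : ∀ S T, c S T ≠ 0 → k ≤ S.card ∧ k ≤ T.card)
    (hU : ∀ S T, ∀ t ∈ T, (poleDeriv a (b t) * c) S T = 0)
    (hV : ∀ S T, ∀ s ∈ S, (c * (poleDeriv b (a s)).transpose) S T = 0) : k < c.rank := by
  induction k generalizing c with
  | zero => exact Matrix.rank_pos_of_ne_zero hc
  | succ k ih =>
    classical
    set A : Finset U := Finset.univ.filter fun u => ∃ S T, u ∈ S ∧ c S T ≠ 0 with hA
    set B : Finset V := Finset.univ.filter fun v => ∃ S T, v ∈ T ∧ c S T ≠ 0 with hB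
    by_cases h1 : ∃ t ∈ B, poleDeriv a (b t) * c ≠ 0
    · obtain ⟨t, ht, hne⟩ := h1
      obtain ⟨S₀, T₀, htT, hST⟩ := (Finset.mem_filter.mp ht).2
      refine (Nat.succ_le_of_lt (ih _ hne ?_ ?_ ?_)).trans_lt
        (Matrix.rank_mul_lt _ c T₀ hST fun S => hU S T₀ t htT)
      · intro S T h
        rw [dirDeriv_mul_apply] at h
        obtain ⟨u, hu, h⟩ := Finset.exists_ne_zero_of_sum_ne_zero h
        have := hdeg _ _ (right_ne_zero_of_mul h)
        rw [Finset.card_insert_of_notMem (Finset.mem_compl.mp hu)] at this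
        omega
      · intro S T t' ht'
        rw [← Matrix.mul_assoc, dirDeriv_mul_comm, Matrix.mul_assoc, dirDeriv_mul_apply]
        exact Finset.sum_eq_zero fun u _ => by rw [hU _ _ t' ht', mul_zero]
      · intro S T s hs
        rw [Matrix.mul_assoc, dirDeriv_mul_apply]
        exact Finset.sum_eq_zero fun u _ => by
          rw [hV _ _ s (Finset.mem_insert_of_mem hs), mul_zero]
    by_cases h2 : ∃ s ∈ A, c * (poleDeriv b (a s)).transpose ≠ 0
    · obtain ⟨s, hs, hne⟩ := h2
      obtain ⟨S₀, T₀, hsS, hST⟩ := (Finset.mem_filter.mp hs).2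
      have hlt : (c * (poleDeriv b (a s)).transpose).rank < c.rank := by
        rw [← Matrix.rank_transpose, ← Matrix.rank_transpose c, Matrix.transpose_mul,
          Matrix.transpose_transpose]
        refine Matrix.rank_mul_lt _ c.transpose S₀ hST fun T => ?_
        rw [← hV S₀ T s hsS, ← Matrix.transpose_apply (c * _), Matrix.transpose_mul,
          Matrix.transpose_transpose]
      refine (Nat.succ_le_of_lt (ih _ hne ?_ ?_ ?_)).trans_lt hlt
      · intro S T h
        rw [mul_dirDeriv_transpose_apply] at h
        obtain ⟨u, hu, h⟩ := Finset.exists_ne_zero_of_sum_ne_zero h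
        have := hdeg _ _ (right_ne_zero_of_mul h)
        rw [Finset.card_insert_of_notMem (Finset.mem_compl.mp hu)] at this
        omega
      · intro S T t ht
        rw [← Matrix.mul_assoc, mul_dirDeriv_transpose_apply]
        exact Finset.sum_eq_zero fun u _ => by
          rw [hU _ _ t (Finset.mem_insert_of_mem ht), mul_zero]
      · intro S T s' hs'
        rw [Matrix.mul_assoc, ← Matrix.transpose_mul, dirDeriv_mul_comm, Matrix.transpose_mul,
          ← Matrix.mul_assoc, mul_dirDeriv_transpose_apply]
        exact Finset.sum_eq_zero fun u _ => by rw [hV _ _ s' hs', mul_zero]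
    exfalso
    push Not at h1 h2
    obtain ⟨S, T, hST⟩ : ∃ S T, c S T ≠ 0 := by
      by_contra! h
      exact hc (by ext S T; exact h S T)
    have hcard := hdeg S T hST
    refine lt_asymm
      (card_lt_card_of_poleDeriv_mul_eq_zero ha hb hab c A B ?_ hST
        (Finset.card_pos.mp (by omega)) h1)
      (card_lt_card_of_poleDeriv_mul_eq_zero hb ha (fun v u => (hab u v).symm) c.transpose B A
        ?_ (T := S) (S := T) hST (Finset.card_pos.mp (by omega)) fun s hs => ?_)
    · exact fun S T h u hu => Finset.mem_filter.mpr ⟨Finset.mem_univ _, S, T, hu, h⟩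
    · exact fun T S h v hv => Finset.mem_filter.mpr ⟨Finset.mem_univ _, S, T, hv, h⟩
    · rw [← Matrix.transpose_transpose (poleDeriv b (a s)), ← Matrix.transpose_mul, h2 s hs,
        Matrix.transpose_zero]

/-- The derivative along `x_s` is the extraction of the coefficient of `x_s`. -/
lemma dirDeriv_single_mul_apply {β : Type*} (s : U) (c : Matrix (Finset U) β F) (S : Finset U)
    (T : β) : (dirDeriv (Pi.single s (1 : F)) * c) S T = if s ∈ S then 0 else c (insert s S) T := by
  rw [dirDeriv_mul_apply]
  simp [Pi.single_apply, ite_mul]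

/-- The rank bound for the coefficient matrix `c` of a homogeneous multilinear polynomial of degree
`N` all of whose monomials have degree at least `m` in the variables of `U`, the value `m` being
attained. Suppose some derivative with pole at `a s` on the side of `V` does not kill the
row of some `S ∋ s` with `m` elements. Taking the coefficient of `x_s` followed by this derivative
lowers both degrees by one. It also lowers the rank, since it kills the rows of largest degree among
those that contain `s`. If there is no such derivative, the bound holds for the monomials of degree
`m` on the side of `U` alone. -/
theorem lt_rank_of_poleDeriv_add_eq_zero {a : U → F} {b : V → F}
    (ha : Function.Injective a) (hb : Function.Injective b) (hab : ∀ u v, a u ≠ b v) (k m N : ℕ)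
    (c : Matrix (Finset U) (Finset V) F)
    (hdeg : ∀ S T, c S T ≠ 0 → m ≤ S.card ∧ S.card + T.card = N)
    (hmin : ∃ S T, S.card = m ∧ c S T ≠ 0) (hkm : k ≤ m) (hkN : m + k ≤ N)
    (hrel : ∀ x S T, ((∃ s ∈ S, a s = x) ∨ ∃ t ∈ T, b t = x) →
      (poleDeriv a x * c + c * (poleDeriv b x).transpose) S T = 0) : k < c.rank := by
  induction k generalizing m N c with
  | zero =>
    obtain ⟨S, T, -, h⟩ := hmin
    exact Matrix.rank_pos_of_ne_zero fun h0 => h (by rw [h0]; rfl)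
  | succ k ih =>
    by_cases hA : ∃ S T, ∃ s ∈ S, S.card = m ∧ (c * (poleDeriv b (a s)).transpose) S T ≠ 0
    · obtain ⟨S, T, s, hs, hSm, hne⟩ := hA
      set r := dirDeriv (Pi.single s (1 : F)) * c with hr
      have hr_apply : ∀ S T, r S T = if s ∈ S then 0 else c (insert s S) T :=
        dirDeriv_single_mul_apply s c
      have hc' : ∀ S T, (r * (poleDeriv b (a s)).transpose) S T =
          if s ∈ S then 0 else (c * (poleDeriv b (a s)).transpose) (insert s S) T := by
        intro S T
        rw [hr, Matrix.mul_assoc, dirDeriv_single_mul_apply]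
      -- The derivative turns the row of a largest `S₁ ∪ {s}` into a combination of rows of larger
      -- sets containing `s`, which vanish.
      have hlt : (r * (poleDeriv b (a s)).transpose).rank < c.rank := by
        refine lt_of_lt_of_le ?_ (Matrix.rank_mul_le_right (dirDeriv (Pi.single s (1 : F))) c)
        rw [← hr, ← Matrix.rank_transpose, ← Matrix.rank_transpose r, Matrix.transpose_mul,
          Matrix.transpose_transpose]
        classical
        obtain ⟨S₁, hS₁, hmax⟩ := Finset.exists_max_image
          (Finset.univ.filter fun S : Finset U => ∃ T, r S T ≠ 0) Finset.card (by
            rw [mul_dirDeriv_transpose_apply] at hne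
            obtain ⟨t, -, ht⟩ := Finset.exists_ne_zero_of_sum_ne_zero hne
            refine ⟨S.erase s, Finset.mem_filter.mpr ⟨Finset.mem_univ _, insert t T, ?_⟩⟩
            rw [hr_apply, if_neg (Finset.notMem_erase s S), Finset.insert_erase hs]
            exact right_ne_zero_of_mul ht)
        obtain ⟨T₁, hT₁⟩ := (Finset.mem_filter.mp hS₁).2
        refine Matrix.rank_mul_lt _ r.transpose S₁ hT₁ fun T => ?_
        rw [← Matrix.transpose_transpose (poleDeriv b (a s)), ← Matrix.transpose_mul,
          Matrix.transpose_apply, hc', ite_eq_left_iff]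
        intro hsS₁
        have h := hrel (a s) (insert s S₁) T (Or.inl ⟨s, Finset.mem_insert_self _ _, rfl⟩)
        rw [Matrix.add_apply, dirDeriv_mul_apply, Finset.sum_eq_zero, zero_add] at h
        · exact h
        intro u hu
        rw [Finset.mem_compl, Finset.mem_insert, not_or] at hu
        rw [mul_eq_zero, or_iff_not_imp_right]
        intro hu0
        have := hmax (insert u S₁) (Finset.mem_filter.mpr ⟨Finset.mem_univ _, T, by
          rw [hr_apply, if_neg, Finset.insert_comm]
          · exact hu0
          · rw [Finset.mem_insert, not_or]
            exact ⟨Ne.symm hu.1, hsS₁⟩⟩)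
        rw [Finset.card_insert_of_notMem hu.2] at this
        omega
      refine (Nat.succ_le_of_lt (ih (m - 1) (N - 2) _ ?_ ⟨S.erase s, T, ?_, ?_⟩ (by omega)
        (by omega) ?_)).trans_lt hlt
      · intro S T h
        rw [hc', ne_eq, ite_eq_left_iff, Classical.not_imp, mul_dirDeriv_transpose_apply] at h
        obtain ⟨hsS, h⟩ := h
        obtain ⟨t, ht, h⟩ := Finset.exists_ne_zero_of_sum_ne_zero h
        have := hdeg _ _ (right_ne_zero_of_mul h)
        rw [Finset.card_insert_of_notMem (Finset.mem_compl.mp ht),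
          Finset.card_insert_of_notMem hsS] at this
        omega
      · rw [Finset.card_erase_of_mem hs, hSm]
      · rwa [hc', if_neg (Finset.notMem_erase s S), Finset.insert_erase hs]
      · intro x S T h
        -- All derivatives commute, so the relations for `c` pass to its derivative.
        have hcomm : poleDeriv a x * (r * (poleDeriv b (a s)).transpose) +
            r * (poleDeriv b (a s)).transpose * (poleDeriv b x).transpose =
            dirDeriv (Pi.single s (1 : F)) * ((poleDeriv a x * c + c * (poleDeriv b x).transpose) *
              (poleDeriv b (a s)).transpose) := by
          rw [Matrix.mul_assoc r, ← Matrix.transpose_mul, dirDeriv_mul_comm, Matrix.transpose_mul,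
            ← Matrix.mul_assoc, ← Matrix.mul_assoc r, ← Matrix.add_mul, ← Matrix.mul_assoc, hr,
            ← Matrix.mul_assoc, dirDeriv_mul_comm, Matrix.mul_assoc, Matrix.mul_assoc,
            Matrix.mul_add]
        rw [hcomm, dirDeriv_mul_apply]
        refine Finset.sum_eq_zero fun u _ => ?_
        rw [mul_dirDeriv_transpose_apply, Finset.sum_eq_zero, mul_zero]
        intro t _
        rw [hrel, mul_zero]
        exact h.imp (fun ⟨s, hs, h⟩ => ⟨s, Finset.mem_insert_of_mem hs, h⟩)
          fun ⟨t, ht, h⟩ => ⟨t, Finset.mem_insert_of_mem ht, h⟩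
    · push Not at hA
      set d := Matrix.diagonal (fun S : Finset U => if S.card = m then (1 : F) else 0) * c with hd
      have hd_apply : ∀ S T, d S T = if S.card = m then c S T else 0 := by
        intro S T
        rw [hd, Matrix.diagonal_mul, ite_mul, one_mul, zero_mul]
      refine lt_of_lt_of_le (lt_rank_of_poleDeriv_eq_zero ha hb hab (k + 1) d ?_ ?_ ?_ ?_)
        (Matrix.rank_mul_le_right _ c)
      · obtain ⟨S, T, hS, h⟩ := hmin
        intro h0
        have := hd_apply S T
        rw [h0, if_pos hS] at this
        exact h this.symm
      · intro S T h
        rw [hd_apply, ne_eq, ite_eq_right_iff, Classical.not_imp] at h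
        have := hdeg S T h.2
        omega
      · intro S T t ht
        rw [dirDeriv_mul_apply]
        by_cases hS : S.card + 1 = m
        · have h := hrel (b t) S T (Or.inr ⟨t, ht, rfl⟩)
          rw [Matrix.add_apply, mul_dirDeriv_transpose_apply, Finset.sum_eq_zero (s := Tᶜ),
            add_zero, dirDeriv_mul_apply] at h
          · rw [← h]
            refine Finset.sum_congr rfl fun u hu => ?_
            rw [hd_apply, if_pos]
            rw [Finset.card_insert_of_notMem (Finset.mem_compl.mp hu), hS]
          · intro v _
            rw [mul_eq_zero, or_iff_not_imp_right]
            intro h0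
            have := hdeg _ _ h0
            omega
        · refine Finset.sum_eq_zero fun u hu => ?_
          rw [hd_apply, if_neg, mul_zero]
          rwa [Finset.card_insert_of_notMem (Finset.mem_compl.mp hu)]
      · intro S T s hs
        rw [mul_dirDeriv_transpose_apply]
        by_cases hS : S.card = m
        · rw [← hA S T s hs hS, mul_dirDeriv_transpose_apply]
          exact Finset.sum_congr rfl fun v _ => by rw [hd_apply, if_pos hS]
        · exact Finset.sum_eq_zero fun v _ => by rw [hd_apply, if_neg hS, mul_zero]

end Rank

/-! ### The vanishing ideal of the generator -/

noncomputable section Generator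

variable {F : Type*} [Field F] {n : ℕ}

/-- The chain rule for a derivation and a polynomial substitution. -/
lemma MvPolynomial.derivation_aeval_eq_sum {σ R A : Type*} [Fintype σ] [CommRing R] [CommRing A]
    [Algebra R A] (D : Derivation R A A) (G : σ → A) (p : MvPolynomial σ R) :
    D (aeval G p) = ∑ s, aeval G (pderiv s p) * D (G s) := by
  classical
  induction p using MvPolynomial.induction_on with
  | C r => simp
  | add p q hp hq => simp [hp, hq, add_mul, Finset.sum_add_distrib]
  | mul_X p i hp =>
    simp only [map_mul, aeval_X, Derivation.leibniz, smul_eq_mul, hp, map_add, add_mul,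
      Finset.sum_add_distrib, pderiv_X, Finset.mul_sum]
    congr 1
    · rw [Finset.sum_eq_single i]
      · simp
      · intro j _ hj
        simp [hj.symm]
      · simp
    · exact Finset.sum_congr rfl fun s _ => by ring

/-- The squarefree monomial with the given set of variables. -/
def squarefreeMonomial {σ : Type*} (S : Finset σ) : σ →₀ ℕ := ∑ i ∈ S, Finsupp.single i 1

lemma squarefreeMonomial_apply {σ : Type*} [DecidableEq σ] (S : Finset σ) (i : σ) :
    squarefreeMonomial S i = if i ∈ S then 1 else 0 := by
  simp [squarefreeMonomial, Finsupp.finsetSum_apply, Finsupp.single_apply]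

lemma squarefreeMonomial_insert {σ : Type*} [DecidableEq σ] {S : Finset σ} {i : σ} (hi : i ∉ S) :
    squarefreeMonomial (insert i S) = Finsupp.single i 1 + squarefreeMonomial S :=
  Finset.sum_insert hi

lemma squarefreeMonomial_degree {σ : Type*} (S : Finset σ) :
    (squarefreeMonomial S).degree = S.card := by
  simp [squarefreeMonomial]

lemma squarefreeMonomial_support {σ : Type*} (S : Finset σ) :
    (squarefreeMonomial S).support = S := by
  classical
  ext i
  simp [squarefreeMonomial_apply]

/-- The substitution that sets the variables outside `L` to zero. -/
def restrictVars (L : Finset (Fin n)) : MvPolynomial (Fin n) F →ₐ[F] MvPolynomial (Fin n) F :=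
  aeval fun i => if i ∈ L then X i else 0

lemma coeff_restrictVars (L : Finset (Fin n)) (p : MvPolynomial (Fin n) F) {μ : Fin n →₀ ℕ}
    (hμ : μ.support ⊆ L) : (restrictVars L p).coeff μ = p.coeff μ := by
  induction p using MvPolynomial.induction_on' with
  | add p q hp hq => simp [hp, hq]
  | monomial ν r =>
    by_cases hν : ν.support ⊆ L
    · have : restrictVars L (monomial ν r) = monomial ν r := by
        rw [restrictVars, aeval_monomial, monomial_eq]
        congr 1
        exact Finsupp.prod_congr fun i hi => by rw [if_pos (hν hi)]
      rw [this]
    · obtain ⟨i, hi, hiL⟩ := Finset.not_subset.mp hν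
      have : restrictVars L (monomial ν r) = 0 := by
        rw [restrictVars, aeval_monomial, Finsupp.prod, Finset.prod_eq_zero hi, mul_zero]
        rw [if_neg hiL, zero_pow (Finsupp.mem_support_iff.mp hi)]
      rw [this, coeff_monomial, if_neg, coeff_zero]
      rintro rfl
      exact hν hμ

/-- The specialization of the seed that places the interpolation points `a i`, `i ∈ L`, at the
indices `g i`, with free coefficients `X i`, and sets the remaining seed variables to zero. -/
def placeSeeds (a : Fin n → F) {l : ℕ} {L : Finset (Fin n)} (g : L → Fin l) :
    MvPolynomial (Fin l ⊕ Fin l) F →ₐ[F] MvPolynomial (Fin n) F :=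
  aeval (Sum.elim (Function.extend g (fun i => C (a i)) 0) (Function.extend g (fun i => X i.1) 0))

lemma placeSeeds_aeval_svGenerator {a : Fin n → F} (ha : Function.Injective a) {l : ℕ}
    {L : Finset (Fin n)} {g : L → Fin l} (hg : Function.Injective g) (p : MvPolynomial (Fin n) F) :
    placeSeeds a g (aeval (svGenerator a l) p) = restrictVars L p := by
  rw [← AlgHom.comp_apply]
  congr 1
  refine algHom_ext fun s => ?_
  rw [AlgHom.comp_apply, restrictVars, aeval_X, aeval_X, svGenerator, map_sum,
    ← Fintype.sum_of_injective g hg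
      (fun i : L => if s = i.1 then (X i.1 : MvPolynomial (Fin n) F) else 0)]
  · rw [Finset.sum_coe_sort L fun i => if s = i then (X i : MvPolynomial (Fin n) F) else 0]
    rw [Finset.sum_ite_eq]
  · intro j hj
    rw [map_mul, placeSeeds, aeval_X, Sum.elim_inr,
      Function.extend_apply' _ _ _ (by simpa using hj)]
    simp
  · intro i
    rw [map_mul, placeSeeds, aeval_X, Sum.elim_inr, hg.extend_apply,
      ← Polynomial.aeval_algHom_apply, aeval_X, Sum.elim_inl, hg.extend_apply, ← algebraMap_eq,
      Polynomial.aeval_algebraMap_apply, Polynomial.coe_aeval_eq_eval]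
    split_ifs with h
    · rw [h, Lagrange.eval_basis_self ha.injOn (Finset.mem_univ _), map_one, mul_one]
    · rw [Lagrange.eval_basis_of_ne h (Finset.mem_univ _), map_zero, mul_zero]

lemma exists_injective_of_card_le {L : Finset (Fin n)} {l : ℕ} (hL : L.card ≤ l) :
    ∃ g : L → Fin l, Function.Injective g := by
  obtain ⟨g⟩ := Function.Embedding.nonempty_of_card_le (α := L) (β := Fin l) (by simpa using hL)
  exact ⟨g, g.injective⟩

/-- A polynomial in the vanishing ideal has no monomial in at most `l` variables. -/
lemma coeff_eq_zero_of_card_support_le {a : Fin n → F} (ha : Function.Injective a) {l : ℕ}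
    {p : MvPolynomial (Fin n) F} (hp : aeval (svGenerator a l) p = 0) {μ : Fin n →₀ ℕ}
    (hμ : μ.support.card ≤ l) : p.coeff μ = 0 := by
  obtain ⟨g, hg⟩ := exists_injective_of_card_le hμ
  rw [← coeff_restrictVars μ.support p subset_rfl, ← placeSeeds_aeval_svGenerator ha hg, hp,
    map_zero, coeff_zero]

/-- Moving an interpolation point away from the node `a i` gives a linear relation between the
coefficients of the squarefree monomials `x_L * x_s`. -/
lemma sum_derivative_basis_mul_coeff_eq_zero {a : Fin n → F} (ha : Function.Injective a) {l : ℕ}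
    {p : MvPolynomial (Fin n) F} (hp : aeval (svGenerator a l) p = 0) {L : Finset (Fin n)}
    (hL : L.card ≤ l) {i : Fin n} (hi : i ∈ L) :
    ∑ s ∈ Lᶜ, (Lagrange.basis Finset.univ a s).derivative.eval (a i) *
      p.coeff (squarefreeMonomial (insert s L)) = 0 := by
  obtain ⟨g, hg⟩ := exists_injective_of_card_le hL
  have hD : ∀ s, placeSeeds a g (pderiv (Sum.inl (g ⟨i, hi⟩)) (svGenerator a l s)) =
      X i * C ((Lagrange.basis Finset.univ a s).derivative.eval (a i)) := by
    intro s
    rw [svGenerator, map_sum, Finset.sum_eq_single (g ⟨i, hi⟩)]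
    · rw [Derivation.leibniz, Derivation.map_aeval, pderiv_X_self,
        pderiv_X_of_ne (by simp), smul_zero, add_zero, smul_eq_mul, smul_eq_mul, mul_one, map_mul,
        placeSeeds, aeval_X, Sum.elim_inr, hg.extend_apply, ← Polynomial.aeval_algHom_apply,
        aeval_X, Sum.elim_inl, hg.extend_apply, ← algebraMap_eq, Polynomial.aeval_algebraMap_apply,
        Polynomial.coe_aeval_eq_eval]
    · intro j _ hj
      rw [Derivation.leibniz, Derivation.map_aeval,
        pderiv_X_of_ne (j := Sum.inl j) fun h => hj (Sum.inl_injective h),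
        pderiv_X_of_ne (by simp)]
      simp
    · simp
  have h := congrArg (placeSeeds a g)
    (derivation_aeval_eq_sum (pderiv (Sum.inl (g ⟨i, hi⟩))) (svGenerator a l) p)
  rw [hp, map_zero, map_zero, map_sum] at h
  simp only [map_mul, placeSeeds_aeval_svGenerator ha hg, hD] at h
  have h' : (X i : MvPolynomial (Fin n) F) * ∑ s,
      C ((Lagrange.basis Finset.univ a s).derivative.eval (a i)) * restrictVars L (pderiv s p) =
        0 := by
    rw [h, Finset.mul_sum]
    exact Finset.sum_congr rfl fun s _ => by ring
  have h'' := congrArg (coeff (squarefreeMonomial L))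
    ((mul_eq_zero.mp h').resolve_left (X_ne_zero i))
  rw [coeff_sum, coeff_zero] at h''
  rw [← h'']
  refine Finset.sum_subset_zero_on_sdiff (Finset.subset_univ _) (fun s hs => ?_) fun s hs => ?_
  · -- For `s ∈ L` the monomial `x_L * x_s` involves only the variables of `L`.
    have hsL : s ∈ L := by simpa using hs
    rw [coeff_C_mul, coeff_restrictVars _ _ (squarefreeMonomial_support L).subset, coeff_pderiv,
      coeff_eq_zero_of_card_support_le ha hp, zero_mul, mul_zero]
    refine (Finset.card_le_card (Finsupp.support_add.trans ?_)).trans hL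
    rw [squarefreeMonomial_support]
    exact Finset.union_subset subset_rfl
      (Finsupp.support_single_subset.trans (Finset.singleton_subset_iff.mpr hsL))
  · rw [Finset.mem_compl] at hs
    rw [coeff_C_mul, coeff_restrictVars _ _ (squarefreeMonomial_support L).subset, coeff_pderiv,
      squarefreeMonomial_insert hs, squarefreeMonomial_apply, if_neg hs, add_comm]
    simp

lemma eval_derivative_basis_of_ne {ι : Type*} [Fintype ι] [DecidableEq ι] {a : ι → F}
    (ha : Function.Injective a) {i s : ι} (hs : s ≠ i) :
    (Lagrange.basis Finset.univ a s).derivative.eval (a i) =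
      (Lagrange.nodalWeight Finset.univ a i)⁻¹ *
        (Lagrange.nodalWeight Finset.univ a s * (a i - a s)⁻¹) := by
  have hne : a i - a s ≠ 0 := sub_ne_zero.mpr fun h => hs (ha h).symm
  rw [Lagrange.basis_eq_prod_sub_inv_mul_nodal_div (Finset.mem_univ _),
    ← Lagrange.nodal_erase_eq_nodal_div (Finset.mem_univ _),
    Lagrange.nodalWeight_eq_eval_nodal_erase_inv (i := i), inv_inv,
    Lagrange.nodal_eq_mul_nodal_erase
      (Finset.mem_erase.mpr ⟨hs.symm, Finset.mem_univ i⟩ : i ∈ Finset.univ.erase s),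
    Lagrange.nodal_eq_mul_nodal_erase
      (Finset.mem_erase.mpr ⟨hs, Finset.mem_univ s⟩ : s ∈ Finset.univ.erase i),
    Finset.erase_right_comm]
  simp only [Polynomial.derivative_mul, Polynomial.derivative_C, Polynomial.derivative_sub,
    Polynomial.derivative_X, Polynomial.eval_mul, Polynomial.eval_add, Polynomial.eval_sub,
    Polynomial.eval_X, Polynomial.eval_C, sub_self, zero_mul, sub_zero, one_mul,
    zero_add, add_zero]
  field_simp

/-- The coefficient of `x_S` after the rescaling of each variable by its nodal weight. In these
coordinates the curve `y ↦ (L_i(y))_i` is proportional to `y ↦ (1 / (y - a_i))_i`. -/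
def scaledCoeff (a : Fin n → F) (p : MvPolynomial (Fin n) F) (S : Finset (Fin n)) : F :=
  p.coeff (squarefreeMonomial S) * ∏ s ∈ S, Lagrange.nodalWeight Finset.univ a s

lemma scaledCoeff_ne_zero_iff {a : Fin n → F} (ha : Function.Injective a)
    {p : MvPolynomial (Fin n) F} {S : Finset (Fin n)} :
    scaledCoeff a p S ≠ 0 ↔ p.coeff (squarefreeMonomial S) ≠ 0 := by
  rw [scaledCoeff, mul_ne_zero_iff, and_iff_left]
  exact Finset.prod_ne_zero_iff.mpr fun s _ =>
    Lagrange.nodalWeight_ne_zero ha.injOn (Finset.mem_univ s)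

lemma sum_inv_sub_mul_scaledCoeff_eq_zero {a : Fin n → F} (ha : Function.Injective a) {l : ℕ}
    {p : MvPolynomial (Fin n) F} (hp : aeval (svGenerator a l) p = 0) {L : Finset (Fin n)}
    (hL : L.card ≤ l) {i : Fin n} (hi : i ∈ L) :
    ∑ s ∈ Lᶜ, (a s - a i)⁻¹ * scaledCoeff a p (insert s L) = 0 := by
  have h := congrArg (fun r => -(Lagrange.nodalWeight Finset.univ a i *
    ∏ s ∈ L, Lagrange.nodalWeight Finset.univ a s) * r)
    (sum_derivative_basis_mul_coeff_eq_zero ha hp hL hi)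
  simp only [mul_zero, Finset.mul_sum] at h
  rw [← h]
  refine Finset.sum_congr rfl fun s hs => ?_
  rw [Finset.mem_compl] at hs
  have hne : s ≠ i := fun h => hs (h ▸ hi)
  have hw := Lagrange.nodalWeight_ne_zero (s := Finset.univ) ha.injOn (Finset.mem_univ i)
  rw [eval_derivative_basis_of_ne ha hne, scaledCoeff, Finset.prod_insert hs, ← neg_sub (a i),
    inv_neg]
  field_simp

end Generator

/-! ### Coefficient matrices of branching programs -/

section Program

/-- The initial part of a polynomial with respect to a grading does not increase the rank of the
coefficient matrix: a relation between rows of `M` restricts, in its top degree, to one between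
rows of the initial part. -/
lemma Matrix.rank_le_rank_of_initial {F α β : Type*} [Field F] [Fintype α] [Fintype β]
    (M M₀ : Matrix α β F) (f : α → ℕ) (g : β → ℕ) (N : ℕ)
    (hlow : ∀ i j, f i + g j < N → M i j = 0)
    (heq : ∀ i j, f i + g j = N → M₀ i j = M i j) (hne : ∀ i j, f i + g j ≠ N → M₀ i j = 0) :
    M₀.rank ≤ M.rank := by
  classical
  obtain ⟨r, hr⟩ : ∃ r : Fin M₀.rank → α, LinearIndependent F (M₀.row ∘ r) := by
    rw [rank_eq_finrank_span_row]
    obtain ⟨f, hf, -, hli⟩ := Submodule.exists_fun_fin_finrank_span_eq F (Set.range M₀.row)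
    choose r hr using hf
    refine ⟨r, ?_⟩
    exact (funext hr : M₀.row ∘ r = f) ▸ hli
  have hli : LinearIndependent F (M.submatrix r id).row := by
    rw [Fintype.linearIndependent_iff] at hr ⊢
    intro c hc
    by_contra! hex
    obtain ⟨i₀, hi₀, hmax⟩ := Finset.exists_max_image (Finset.univ.filter fun i => c i ≠ 0)
      (fun i => f (r i)) (hex.imp fun i hi => Finset.mem_filter.mpr ⟨Finset.mem_univ _, hi⟩)
    -- The top-degree part of the relation `c`.
    set c' : Fin M₀.rank → F := fun i => if f (r i) = f (r i₀) then c i else 0 with hc'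
    refine (Finset.mem_filter.mp hi₀).2 ((if_pos rfl).symm.trans (hr c' ?_ i₀))
    ext j
    have hj := congrFun hc j
    simp only [Finset.sum_apply, Pi.smul_apply, smul_eq_mul, Matrix.row, Pi.zero_apply,
      Function.comp, Matrix.submatrix_apply, id] at hj ⊢
    by_cases hN : f (r i₀) + g j = N
    · rw [← hj]
      refine Finset.sum_congr rfl fun i _ => ?_
      rcases lt_trichotomy (f (r i)) (f (r i₀)) with h | h | h
      · rw [hlow _ _ (by omega), hne _ _ (by omega), mul_zero, mul_zero]
      · rw [hc', heq _ _ (by omega)]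
        simp only [h, if_true]
      · have h0 : c i = 0 := by
          by_contra h0
          exact absurd (hmax i (Finset.mem_filter.mpr ⟨Finset.mem_univ _, h0⟩)) (by omega)
        simp [hc', h0]
    · refine Finset.sum_eq_zero fun i _ => ?_
      by_cases h : f (r i) = f (r i₀)
      · rw [hne _ _ (by omega), mul_zero]
      · simp [hc', h]
  have := hli.rank_matrix
  rw [Fintype.card_fin] at this
  rw [← this]
  exact M.rank_submatrix_le r id

variable {F : Type*} [Field F] {n : ℕ}

lemma MvPolynomial.coeff_prod_aeval_X {σ R : Type*} [CommSemiring R] [Fintype σ]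
    (f : σ → Polynomial R) (μ : σ →₀ ℕ) :
    (∏ i, Polynomial.aeval (X i : MvPolynomial σ R) (f i)).coeff μ = ∏ i, (f i).coeff (μ i) := by
  classical
  have hsum (κ : σ → ℕ) : ∑ i, Finsupp.single i (κ i) = Finsupp.equivFunOnFinite.symm κ := by
    ext j
    simp [Finsupp.finsetSum_apply, Finsupp.single_apply]
  have hmon (κ : σ → ℕ) : ∏ i, monomial (Finsupp.single i (κ i)) ((f i).coeff (κ i)) =
      monomial (Finsupp.equivFunOnFinite.symm κ) (∏ i, (f i).coeff (κ i)) := by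
    rw [← hsum]
    induction (Finset.univ : Finset σ) using Finset.induction_on with
    | empty => simp
    | insert i s hi ih =>
      rw [Finset.prod_insert hi, Finset.prod_insert hi, Finset.sum_insert hi, ih, monomial_mul]
  have hf (i : σ) : Polynomial.aeval (X i : MvPolynomial σ R) (f i) =
      ∑ k ∈ (f i).support, monomial (Finsupp.single i k) ((f i).coeff k) := by
    rw [Polynomial.aeval_eq_sum_range' (Nat.lt_succ_self _),
      Finset.sum_subset (Polynomial.supp_subset_range (Nat.lt_succ_self _))]
    · refine Finset.sum_congr rfl fun k _ => ?_
      rw [X_pow_eq_monomial, smul_monomial, smul_eq_mul, mul_one]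
    · intro k _ hk
      rw [Polynomial.notMem_support_iff.mp hk, monomial_zero]
  simp only [hf, Finset.prod_univ_sum, hmon, coeff_sum, coeff_monomial]
  rw [Finset.sum_eq_single (μ : σ → ℕ)]
  · rw [if_pos (by ext; simp)]
  · intro κ _ hκ
    rw [if_neg]
    rintro rfl
    exact hκ (by ext; simp)
  · intro hμ
    rw [Fintype.mem_piFinset, not_forall] at hμ
    obtain ⟨i, hi⟩ := hμ
    rw [Finset.prod_eq_zero (Finset.mem_univ i) (Polynomial.notMem_support_iff.mp hi), ite_self]

lemma ROABP.coeff_poly (P : ROABP F n) (μ : Fin n →₀ ℕ) :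
    P.poly.coeff μ = ∑ q : P.Path, ∏ i : Fin n,
      (P.label i (q i.castSucc) (q i.succ)).coeff (μ (P.order i)) := by
  rw [ROABP.poly, coeff_sum]
  refine Finset.sum_congr rfl fun q _ => ?_
  let f (j : Fin n) : Polynomial F := P.label (P.order.symm j) (q (P.order.symm j).castSucc)
    (q (P.order.symm j).succ)
  have hf (k : Fin n) : f (P.order k) = P.label k (q k.castSucc) (q k.succ) := by
    simp only [f]
    rw [Equiv.symm_apply_apply]
  have h₁ := Equiv.prod_comp P.order fun j => Polynomial.aeval (X j : MvPolynomial (Fin n) F) (f j)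
  have h₂ := Equiv.prod_comp P.order fun j => (f j).coeff (μ j)
  simp only [hf] at h₁ h₂
  rw [h₁, h₂]
  exact coeff_prod_aeval_X f μ

/-- The coefficient matrix of a program across a cut of the variable order has rank at most the
size of the layer at the cut. -/
lemma ROABP.rank_coeff_le_size (P : ROABP F n) (t : Fin (n + 1)) {α β : Type*} [Fintype α]
    [Fintype β] (μ : α → β → Fin n →₀ ℕ) (x : α → Fin n → ℕ) (y : β → Fin n → ℕ)
    (hx : ∀ i j k, k.castSucc < t → μ i j (P.order k) = x i k)
    (hy : ∀ i j k, t ≤ k.castSucc → μ i j (P.order k) = y j k) :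
    (Matrix.of fun i j => P.poly.coeff (μ i j)).rank ≤ P.size t := by
  classical
  let e := Equiv.piEquivPiSubtypeProd (fun i : Fin (n + 1) => i ≤ t) fun i => Fin (P.size i)
  let ev (q : (i : {i : Fin (n + 1) // i ≤ t}) → Fin (P.size i)) : Fin (P.size t) := q ⟨t, le_rfl⟩
  let A : Matrix α ((i : {i : Fin (n + 1) // i ≤ t}) → Fin (P.size i)) F := fun i q =>
    ∏ k : {k : Fin n // k.castSucc < t},
      (P.label k.1 (q ⟨k.1.castSucc, k.2.le⟩)
        (q ⟨k.1.succ, Fin.castSucc_lt_iff_succ_le.mp k.2⟩)).coeff (x i k.1)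
  let G (q : (i : {i : Fin (n + 1) // i ≤ t}) → Fin (P.size i)) (j : β) : F :=
    ∑ q' : (i : {i : Fin (n + 1) // ¬ i ≤ t}) → Fin (P.size i),
      ∏ k : {k : Fin n // ¬ k.castSucc < t},
        (P.label k.1 (e.symm (q, q') k.1.castSucc) (e.symm (q, q') k.1.succ)).coeff (y j k.1)
  -- The right half of a path enters only through its node at the cut.
  have hG : Function.FactorsThrough G ev := by
    intro q r hqr
    have hagree (q') (m : Fin (n + 1)) (hm : t ≤ m) : e.symm (q, q') m = e.symm (r, q') m := by
      rcases hm.eq_or_lt with rfl | hm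
      · simpa [e, Equiv.piEquivPiSubtypeProd] using hqr
      · simp [e, Equiv.piEquivPiSubtypeProd, hm.not_ge]
    funext j
    refine Finset.sum_congr rfl fun q' _ => Finset.prod_congr rfl fun k _ => ?_
    have hk : t ≤ k.1.castSucc := not_lt.mp k.2
    rw [hagree _ _ hk, hagree _ _ (hk.trans k.1.castSucc_lt_succ.le)]
  let B : Matrix (Fin (P.size t)) β F := Function.extend ev G 0
  have hmul : (Matrix.of fun i j => P.poly.coeff (μ i j)) = A * B.submatrix ev id := by
    ext i j
    rw [Matrix.of_apply, ROABP.coeff_poly, Matrix.mul_apply, ← e.symm.sum_comp,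
      Fintype.sum_prod_type]
    refine Finset.sum_congr rfl fun q _ => ?_
    rw [Matrix.submatrix_apply, show B (ev q) = G q from hG.extend_apply _ q, Finset.mul_sum]
    refine Finset.sum_congr rfl fun q' _ => ?_
    rw [← Fintype.prod_subtype_mul_prod_subtype (fun k : Fin n => k.castSucc < t)]
    congr 1
    · refine Finset.prod_congr rfl fun k _ => ?_
      rw [hx i j k.1 k.2]
      have h1 : k.1.castSucc ≤ t := k.2.le
      have h2 : k.1.succ ≤ t := Fin.castSucc_lt_iff_succ_le.mp k.2
      simp [e, Equiv.piEquivPiSubtypeProd, h1, h2]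
    · exact Finset.prod_congr rfl fun k _ => by rw [hy i j k.1 (not_lt.mp k.2), id]
  rw [hmul]
  refine (Matrix.rank_mul_le_right _ _).trans ((B.rank_submatrix_le ev id).trans ?_)
  simpa using B.rank_le_card_height

end Program

/-! ### The bound on the width -/

section Cut

variable {F : Type*} [Field F] {n : ℕ}

/-- The union of a set of elements satisfying `q` and a set of elements not satisfying `q`, the two
sets being given on the subtypes, which are the two sides of a cut. -/
def glue {σ : Type*} [DecidableEq σ] {q : σ → Prop} (S : Finset {i // q i})
    (T : Finset {i // ¬ q i}) : Finset σ :=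
  S.map (Function.Embedding.subtype _) ∪ T.map (Function.Embedding.subtype _)

section Glue

variable {σ : Type*} [DecidableEq σ] {q : σ → Prop}

omit [DecidableEq σ] in
lemma disjoint_map_subtype (S : Finset {i // q i}) (T : Finset {i // ¬ q i}) :
    Disjoint (S.map (Function.Embedding.subtype _)) (T.map (Function.Embedding.subtype _)) := by
  rw [Finset.disjoint_left]
  simp only [Finset.mem_map, Function.Embedding.subtype_apply]
  rintro _ ⟨s, -, rfl⟩ ⟨t, -, h⟩
  exact t.2 (h ▸ s.2)

lemma card_glue (S : Finset {i // q i}) (T : Finset {i // ¬ q i}) :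
    (glue S T).card = S.card + T.card := by
  rw [glue, Finset.card_union_of_disjoint (disjoint_map_subtype S T), Finset.card_map,
    Finset.card_map]

lemma mem_glue_of_pos (S : Finset {i // q i}) (T : Finset {i // ¬ q i}) {i : σ} (hi : q i) :
    i ∈ glue S T ↔ i ∈ S.map (Function.Embedding.subtype _) := by
  simp [glue, hi]

lemma mem_glue_of_neg (S : Finset {i // q i}) (T : Finset {i // ¬ q i}) {i : σ} (hi : ¬ q i) :
    i ∈ glue S T ↔ i ∈ T.map (Function.Embedding.subtype _) := by
  simp [glue, hi]

lemma glue_insert_left [DecidableEq {i // q i}] (S : Finset {i // q i}) (T : Finset {i // ¬ q i})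
    (u : {i // q i}) : glue (insert u S) T = insert u.1 (glue S T) := by
  rw [glue, Finset.map_insert, Finset.insert_union]
  rfl

lemma glue_insert_right [DecidableEq {i // ¬ q i}] (S : Finset {i // q i})
    (T : Finset {i // ¬ q i}) (v : {i // ¬ q i}) :
    glue S (insert v T) = insert v.1 (glue S T) := by
  rw [glue, Finset.map_insert, Finset.union_insert]
  rfl

lemma glue_subtype [DecidablePred q] (R : Finset σ) :
    glue (R.subtype q) (R.subtype fun i => ¬ q i) = R := by
  ext i
  by_cases hi : q i <;> simp [glue, hi]

lemma sum_compl_glue {M : Type*} [AddCommMonoid M] [Fintype σ] [DecidablePred q]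
    (S : Finset {i // q i}) (T : Finset {i // ¬ q i}) (f : σ → M) :
    ∑ i ∈ (glue S T)ᶜ, f i = ∑ u ∈ Sᶜ, f u + ∑ v ∈ Tᶜ, f v := by
  have : (glue S T)ᶜ = glue Sᶜ Tᶜ := by
    ext i
    by_cases hi : q i <;> simp [glue, hi]
  rw [this, glue, Finset.sum_union (disjoint_map_subtype _ _), Finset.sum_map, Finset.sum_map]
  rfl

end Glue

/-- A monomial whose degree is at most its number of variables is squarefree. -/
lemma eq_squarefreeMonomial_of_degree_le {σ : Type*} {μ : σ →₀ ℕ}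
    (h : μ.degree ≤ μ.support.card) : μ = squarefreeMonomial μ.support := by
  classical
  ext i
  rw [squarefreeMonomial_apply]
  by_cases hi : i ∈ μ.support
  · rw [if_pos hi]
    have hle : ∀ j ∈ μ.support, 1 ≤ μ j := fun j hj =>
      Nat.one_le_iff_ne_zero.mpr (Finsupp.mem_support_iff.mp hj)
    have heq : ∑ j ∈ μ.support, 1 = ∑ j ∈ μ.support, μ j :=
      le_antisymm (Finset.sum_le_sum hle) 
        ((show ∑ j ∈ μ.support, μ j ≤ _ from h).trans_eq (by simp))
    exact ((Finset.sum_eq_sum_iff_of_le hle).mp heq i hi).symm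
  · rw [if_neg hi, Finsupp.notMem_support_iff.mp hi]

/-- There is a cut of the variable order at which the least degree on the left side, over a family
of sets of size `N`, equals any prescribed `k ≤ N`, because this degree grows by at most one from
each cut to the next. -/
lemma exists_cut {σ : Type*} {n : ℕ} (pos : σ ≃ Fin n) (C : Finset σ → Prop) {k N : ℕ}
    (hC : ∀ S, C S → S.card = N) (hne : ∃ S, C S) (hk : k ≤ N) :
    ∃ t ≤ n, (∀ S, C S → k ≤ (S.filter fun i => (pos i).val < t).card) ∧
      ∃ S, C S ∧ (S.filter fun i => (pos i).val < t).card = k := by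
  classical
  have hex : ∃ t, ∀ S, C S → k ≤ (S.filter fun i => (pos i).val < t).card :=
    ⟨n, fun S hS => by rw [Finset.filter_true_of_mem fun i _ => (pos i).2, hC S hS]; exact hk⟩
  have hspec := Nat.find_spec hex
  have hle : Nat.find hex ≤ n := Nat.find_min' hex fun S hS => by
    rw [Finset.filter_true_of_mem fun i _ => (pos i).2, hC S hS]; exact hk
  refine ⟨Nat.find hex, hle, hspec, ?_⟩
  rcases Nat.eq_zero_or_pos (Nat.find hex) with h0 | hpos
  · obtain ⟨S, hS⟩ := hne
    have := hspec S hS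
    refine ⟨S, hS, ?_⟩
    rw [h0] at this ⊢
    simp only [Nat.not_lt_zero, Finset.filter_false, Finset.card_empty] at this ⊢
    omega
  · have hmin := Nat.find_min hex (Nat.sub_one_lt_of_lt hpos)
    push Not at hmin
    obtain ⟨S, hS, hlt⟩ := hmin
    refine ⟨S, hS, le_antisymm ?_ (hspec S hS)⟩
    set t := Nat.find hex
    have hsub : (S.filter fun i => (pos i).val < t) ⊆
        insert (pos.symm ⟨t - 1, by omega⟩) (S.filter fun i => (pos i).val < t - 1) := by
      intro i hi
      rw [Finset.mem_filter] at hi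
      rw [Finset.mem_insert, Finset.mem_filter, Equiv.eq_symm_apply, Fin.ext_iff]
      by_cases h : (pos i).val = t - 1
      · exact Or.inl h
      · exact Or.inr ⟨hi.1, by omega⟩
    have := (Finset.card_le_card hsub).trans (Finset.card_insert_le _ _)
    omega

/-- A program that computes a polynomial in the vanishing ideal with a monomial of degree at most
`l + 1` has width more than `(l + 1) / 2`. -/
theorem ROABP.half_lt_width {a : Fin n → F} (ha : Function.Injective a) {l : ℕ} (P : ROABP F n)
    (hp : aeval (svGenerator a l) P.poly = 0) {ν : Fin n →₀ ℕ} (hν : ν ∈ P.poly.support)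
    (hdeg : ν.degree ≤ l + 1) : (l + 1) / 2 < P.width := by
  classical
  have hlow : ∀ S : Finset (Fin n), S.card < l + 1 → P.poly.coeff (squarefreeMonomial S) = 0 :=
    fun S hS => coeff_eq_zero_of_card_support_le ha hp (by
      rw [squarefreeMonomial_support]; omega)
  have hcard : l + 1 ≤ ν.support.card := by
    by_contra! h
    exact mem_support_iff.mp hν (coeff_eq_zero_of_card_support_le ha hp (by omega))
  have hνeq := eq_squarefreeMonomial_of_degree_le (hdeg.trans hcard)
  have hνcard : ν.support.card = l + 1 := by
    rw [hνeq, squarefreeMonomial_degree] at hdeg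
    omega
  obtain ⟨t, htn, hmin, S₀, ⟨hS₀, hS₀ne⟩, hS₀t⟩ := exists_cut P.order.symm
    (fun S => S.card = l + 1 ∧ scaledCoeff a P.poly S ≠ 0) (k := (l + 1) / 2) (N := l + 1)
    (fun S h => h.1) ⟨ν.support, hνcard, by
      rw [scaledCoeff_ne_zero_iff ha, ← hνeq]; exact mem_support_iff.mp hν⟩ (by omega)
  let q : Fin n → Prop := fun i => (P.order.symm i).val < t
  let M : Matrix (Finset {i // q i}) (Finset {i // ¬ q i}) F :=
    Matrix.of fun S T => P.poly.coeff (squarefreeMonomial (glue S T))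
  let c : Matrix (Finset {i // q i}) (Finset {i // ¬ q i}) F := fun S T =>
    if S.card + T.card = l + 1 then scaledCoeff a P.poly (glue S T) else 0
  -- `c` is the part of degree `l + 1` of `M`, rescaled by the nodal weights.
  have hsplit (R : Finset (Fin n)) : (R.subtype q).card = (R.filter q).card := by
    rw [← Finset.subtype_map, Finset.card_map]
  have hMsize : M.rank ≤ P.width := by
    refine le_trans (P.rank_coeff_le_size ⟨t, by omega⟩ _
      (fun S k => if P.order k ∈ S.map (Function.Embedding.subtype _) then 1 else 0)
      (fun T k => if P.order k ∈ T.map (Function.Embedding.subtype _) then 1 else 0)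
      (fun S T k hk => ?_) fun S T k hk => ?_) (Finset.le_sup (Finset.mem_univ _))
    · have : q (P.order k) := by simpa [q, Fin.lt_def] using hk
      rw [squarefreeMonomial_apply]
      simp only [mem_glue_of_pos S T this]
    · have : ¬ q (P.order k) := by simpa [q, Fin.le_def] using hk
      rw [squarefreeMonomial_apply]
      simp only [mem_glue_of_neg S T this]
  have hcM : c.rank ≤ M.rank := by
    let w := Lagrange.nodalWeight Finset.univ a
    let M' := Matrix.diagonal (fun S : Finset {i // q i} => ∏ s ∈ S, w s) * M *
      Matrix.diagonal (fun T : Finset {i // ¬ q i} => ∏ t ∈ T, w t)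
    have hM' (S T) : M' S T = scaledCoeff a P.poly (glue S T) := by
      simp only [M', M, Matrix.mul_diagonal, Matrix.diagonal_mul, Matrix.of_apply, scaledCoeff]
      rw [glue, Finset.prod_union (disjoint_map_subtype S T), Finset.prod_map, Finset.prod_map]
      simp only [Function.Embedding.subtype_apply, w]
      ring
    refine le_trans (Matrix.rank_le_rank_of_initial M' c Finset.card Finset.card (l + 1)
      (fun S T h => ?_) (fun S T h => ?_) fun S T h => ?_)
      ((Matrix.rank_mul_le_left _ _).trans (Matrix.rank_mul_le_right _ _))
    · rw [hM', scaledCoeff, hlow _ (by rwa [card_glue]), zero_mul]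
    · rw [hM']
      exact if_pos h
    · exact if_neg h
  refine (lt_rank_of_poleDeriv_add_eq_zero (a := fun u : {i // q i} => a u)
    (b := fun v : {i // ¬ q i} => a v) (ha.comp Subtype.val_injective)
    (ha.comp Subtype.val_injective) (fun u v h => v.2 (ha h ▸ u.2)) ((l + 1) / 2) ((l + 1) / 2)
    (l + 1) c (fun S T h => ?_) ⟨S₀.subtype q, S₀.subtype fun i => ¬ q i, ?_, ?_⟩ le_rfl (by omega)
    fun x S T hx => ?_).trans_le (hcM.trans hMsize)
  · simp only [c, ne_eq, ite_eq_right_iff, Classical.not_imp] at h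
    refine ⟨?_, h.1⟩
    have := hmin (glue S T) ⟨by rw [card_glue, h.1], h.2⟩
    convert this using 1
    rw [← hsplit]
    congr 1
    ext u
    rw [Finset.mem_subtype, mem_glue_of_pos S T u.2]
    simpa using fun _ : u ∈ S => u.2
  · rw [hsplit]
    exact hS₀t
  · have hcg := card_glue (S₀.subtype q) (S₀.subtype fun i => ¬ q i)
    rw [glue_subtype, hS₀] at hcg
    simp only [c]
    rw [if_pos hcg.symm, glue_subtype]
    exact hS₀ne
  · rw [Matrix.add_apply, dirDeriv_mul_apply, mul_dirDeriv_transpose_apply]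
    by_cases h : S.card + T.card = l
    · obtain ⟨i, hi, rfl⟩ : ∃ i ∈ glue S T, a i = x := by
        rcases hx with ⟨s, hs, h⟩ | ⟨s, hs, h⟩
        · exact ⟨s, (mem_glue_of_pos S T s.2).mpr (Finset.mem_map_of_mem _ hs), h⟩
        · exact ⟨s, (mem_glue_of_neg S T s.2).mpr (Finset.mem_map_of_mem _ hs), h⟩
      have hrel := sum_inv_sub_mul_scaledCoeff_eq_zero ha hp (by rw [card_glue, h]) hi
      rw [sum_compl_glue] at hrel
      rw [← hrel]
      congr 1
      · refine Finset.sum_congr rfl fun u hu => ?_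
        simp only [c]
        rw [if_pos, glue_insert_left]
        rw [Finset.card_insert_of_notMem (Finset.mem_compl.mp hu)]
        omega
      · refine Finset.sum_congr rfl fun v hv => ?_
        simp only [c]
        rw [if_pos, glue_insert_right]
        rw [Finset.card_insert_of_notMem (Finset.mem_compl.mp hv)]
        omega
    · rw [Finset.sum_eq_zero, Finset.sum_eq_zero, add_zero]
      · intro v hv
        simp only [c]
        rw [if_neg, mul_zero]
        rw [Finset.card_insert_of_notMem (Finset.mem_compl.mp hv)]
        omega
      · intro u hu
        simp only [c]
        rw [if_neg, mul_zero]
        rw [Finset.card_insert_of_notMem (Finset.mem_compl.mp hu)]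
        omega

end Cut

theorem theorem3 {F : Type*} [Field F] {n : ℕ} (a : Fin n → F) (ha : Function.Injective a)
    (l : ℕ) (hl : 1 ≤ l) :
    Hits (svGenerator a l)
      {p | (∃ P : ROABP F n, P.poly = p ∧ (P.width : ℚ) < (l : ℚ) / 3 + 1) ∧
        ∃ m ∈ p.support, m.degree ≤ l + 1} ∧
    ∀ p ∈ vanishingIdealOf (svGenerator a l), p ≠ 0 → p.totalDegree = l + 1 →
      ∀ P : ROABP F n, P.poly = p → (l : ℚ) / 3 + 1 ≤ (P.width : ℚ) := by
  have key (P : ROABP F n) (hp : aeval (svGenerator a l) P.poly = 0)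
      (h : ∃ m ∈ P.poly.support, m.degree ≤ l + 1) : (l : ℚ) / 3 + 1 ≤ (P.width : ℚ) := by
    obtain ⟨m, hm, hdeg⟩ := h
    have hw : l + 3 ≤ 3 * P.width := by
      have := P.half_lt_width ha hp hm hdeg
      omega
    have : (l : ℚ) + 3 ≤ 3 * P.width := by exact_mod_cast hw
    linarith
  refine ⟨?_, ?_⟩
  · rintro p ⟨⟨P, rfl, hlt⟩, h⟩ - hp
    exact (key P hp h).not_gt hlt
  · rintro p hp hne htot P rfl
    obtain ⟨m, hm⟩ := support_nonempty.mpr hne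
    exact key P hp ⟨m, hm, (le_totalDegree hm).trans_eq htot⟩
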